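/- Consider the $k$-armed stochastic bandit with horizon $T$: in each round $t\in\{1,\dots,T\}$ the learner chooses an action $\pi_t\in\{1,\dots,k\}$ and then observes a reward drawn, independently of the past given the action, from an unknown distribution $\mathcal D_{\pi_t}$. An environment $\mathcal D=(\mathcal D_1,\dots,\mathcal D_k)$ consists of probability distributions on $\mathbb R$ with means $\mu_1,\dots,\mu_k$ that are standardized sub-Gaussian, i.e. $\mathbb E_{X\sim\mathcal D_i}\,e^{s(X-\mu_i)}\le e^{s^2/2}$ for all $s\in\mathbb R$, and satisfy $|\mu_i-\mu_j|\le 1$ for all $i,j$. A policy $\pi$ is a sequence of probability kernels, one for each round, from the past actions and rewards to the next action; $\mathbb P^\pi_{\mathcal D}$ and $\mathbb E^\pi_{\mathcal D}$ denote the induced law and expectation. For an integer $S\ge 1$, $\pi$ is an $S$-switch policy ($\pi\in\Pi_S$) if for every environment $\mathcal D$ the number of $t\in\{1,\dots,T-1\}$ with $\pi_t\neq\pi_{t+1}$ is at most $S$ with $\mathbb P^\pi_{\mathcal D}$-probability $1$. The regret of $\pi$ is $$R^\pi(T)=\sup_{\mathcal D}\Big\{T\max_i\mu_i-\mathbb E^\pi_{\mathcal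 D}\Big[\sum_{t=1}^T\mu_{\pi_t}\Big]\Big\}.$$ **Theorem 2.** There exists an absolute constant $C>0$ such that for all integers $k\ge 2$, $S\ge 1$, $T\ge k$ and every policy $\pi\in\Pi_S$, $$ R^\pi(T)\ge \begin{cases} C\left(k^{-\frac32-\frac{1}{2-2^{-m(S)}}}\,(m(S)+1)^{-2}\right)T^{\frac{1}{2-2^{-m(S)}}}, & \text{if } m(S)\le\log_2\log_2(T/k),\\ C\sqrt{kT}, & \text{if } m(S)>\log_2\log_2(T/k), \end{cases} $$ where $m(S)=\left\lfloor\frac{S-1}{k-1}\right\rfloor$, and $\log_2\log_2(T/k)$ is read as $-\infty$ when $T=k$. -/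

import Mathlib

open MeasureTheory ProbabilityTheory
open scoped NNReal ENNReal

noncomputable section

namespace Bandit

/-- An environment of the `k`-armed stochastic bandit: one reward distribution per action.
Each distribution is standardized sub-Gaussian, that is, `E exp (s (X - μ)) ≤ exp (s ^ 2 / 2)` for
all real `s` where `μ` is its mean, and any two means differ by at most `1`. -/
structure Env (k : ℕ) where
  /-- The reward distribution of each action. -/
  dist : Fin k → Measure ℝ
  isProbabilityMeasure_dist : ∀ i, IsProbabilityMeasure (dist i)
  subgaussian : ∀ i, HasSubgaussianMGF (fun x => x - ∫ y, y ∂(dist i)) 1 (dist i)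
  gap_le_one : ∀ i j, |(∫ y, y ∂(dist i)) - ∫ y, y ∂(dist j)| ≤ 1

namespace Env

variable {k : ℕ}

/-- The expected reward of an action. -/
def mean (D : Env k) (i : Fin k) : ℝ := ∫ y, y ∂(D.dist i)

/-- The expected reward of the best action. -/
def bestMean (D : Env k) : ℝ := ⨆ i, D.mean i

/-- The kernel that sends an action to its reward distribution. -/
def rewardKernel (D : Env k) : Kernel (Fin k) ℝ := Kernel.ofFunOfCountable D.dist

instance (D : Env k) : IsMarkovKernel D.rewardKernel := ⟨D.isProbabilityMeasure_dist⟩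

end Env

/-- Histories of `n` rounds: the action chosen and the reward observed in each of them. -/
abbrev History (k n : ℕ) : Type := Fin n → Fin k × ℝ

/-- A (randomized, non-anticipating) policy: given the history of the first `n` rounds, a
probability distribution over the action of the next round, depending measurably on the history.
When the horizon is `T`, only the kernels for `n < T` are used. -/
structure Policy (k : ℕ) where
  /-- The conditional distribution of the action of the round that follows a history. -/
  kernel : (n : ℕ) → Kernel (History k n) (Fin k)
  isMarkovKernel_kernel : ∀ n, IsMarkovKernel (kernel n)

/-- The history of `n + 1` rounds that extends a history of `n` rounds by one further round. -/
def appendRound {k n : ℕ} (p : History k n × (Fin k × ℝ)) : History k (n + 1) :=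
  Fin.snoc (α := fun _ => Fin k × ℝ) p.1 p.2

theorem measurable_appendRound {k n : ℕ} :
    Measurable (appendRound : History k n × (Fin k × ℝ) → History k (n + 1)) := by
  refine measurable_pi_iff.2 fun i => ?_
  refine Fin.lastCases ?_ (fun j => ?_) i
  · simp only [appendRound, Fin.snoc_last]
    exact measurable_snd
  · simp only [appendRound, Fin.snoc_castSucc]
    exact (measurable_pi_apply j).comp measurable_fst

namespace Policy

variable {k : ℕ}

instance (π : Policy k) (n : ℕ) : IsMarkovKernel (π.kernel n) := π.isMarkovKernel_kernel n

/-- The conditional law, given the history of the first `n` rounds, of the action and the reward of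
the next round: the action is drawn from the policy, then the reward from the distribution of that
action. -/
def stepKernel (π : Policy k) (D : Env k) (n : ℕ) : Kernel (History k n) (Fin k × ℝ) :=
  (π.kernel n) ⊗ₖ (Kernel.prodMkLeft (History k n) D.rewardKernel)

instance (π : Policy k) (D : Env k) (n : ℕ) : IsMarkovKernel (π.stepKernel D n) := by
  unfold stepKernel; infer_instance

/-- The probability measure that a policy and an environment induce on the history of the first `n`
rounds. -/
def law (π : Policy k) (D : Env k) : (n : ℕ) → Measure (History k n)
  | 0 => Measure.dirac Fin.elim0
  | n + 1 => ((law π D n) ⊗ₘ (π.stepKernel D n)).map appendRound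

instance (π : Policy k) (D : Env k) (n : ℕ) : IsProbabilityMeasure (π.law D n) := by
  induction n with
  | zero => unfold law; infer_instance
  | succ n ih => exact Measure.isProbabilityMeasure_map measurable_appendRound.aemeasurable

/-- The number of switches in a history: the number of rounds `t` such that there is a round
`t + 1` and the action chosen in it differs from the action chosen in round `t`. -/
def switchCount {T : ℕ} (h : History k T) : ℕ :=
  (Finset.univ.filter fun t : Fin T =>
    ∃ ht : (t : ℕ) + 1 < T, (h t).1 ≠ (h ⟨(t : ℕ) + 1, ht⟩).1).card

/-- `π` is an `S`-switch policy for the horizon `T`: in every environment, it makes at most `S`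
switches in the first `T` rounds with probability one. -/
def IsSwitchPolicy (π : Policy k) (S T : ℕ) : Prop :=
  ∀ D : Env k, ∀ᵐ h ∂(π.law D T), switchCount h ≤ S

/-- The regret `T μ* - E [∑ₜ μ (πₜ)]` of a policy over `T` rounds in a given environment. -/
def envRegret (π : Policy k) (D : Env k) (T : ℕ) : ℝ :=
  T * D.bestMean - ∫ h, ∑ t : Fin T, D.mean (h t).1 ∂(π.law D T)

/-- The (worst-case) regret of a policy over `T` rounds: the supremum over all environments, taken
in the extended reals. -/
def regret (π : Policy k) (T : ℕ) : EReal :=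
  ⨆ D : Env k, ((π.envRegret D T : ℝ) : EReal)

end Policy

/-- `m(S) = ⌊(S - 1) / (k - 1)⌋`, written with natural numbers; it is used for `S ≥ 1` and `k ≥ 2`
only, where both subtractions are exact and the divisor is positive. -/
def phaseIndex (k S : ℕ) : ℕ := (S - 1) / (k - 1)

/-- The condition `m ≤ log₂ log₂ (T / k)` for `1 ≤ k ≤ T`, with the usual convention that
`log₂ log₂ 1 = log₂ 0 = -∞` lies below every `m`. -/
def LeLogLog (m k T : ℕ) : Prop :=
  k < T ∧ (m : ℝ) ≤ Real.logb 2 (Real.logb 2 ((T : ℝ) / (k : ℝ)))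

end Bandit

end

/-!
The proof compares a policy's behaviour in the null environment, where all rewards are standard
Gaussian, with its behaviour when the mean of a single action `i` is moved to `δ` or `-δ`.

*Change of measure* (`actionProb_nullEnv_le`, `sq_actionProb_mul_exp_le`). The likelihood ratios of
the environments with means `δ` and `-δ` with respect to the null environment multiply to
`exp (- δ ^ 2)` for each choice of `i`. Hence, by the Cauchy-Schwarz inequality, an event of
probability `p` in the null environment before whose decision `i` is chosen at most `N` times has
probability at least `p ^ 2 * exp (- N * δ ^ 2)` in both perturbed environments. This holds for
events decided at a stopping time as well, since the Cauchy-Schwarz inequality also applies to the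
sum over the possible values of the stopping time.

*The bound `√(k T)`* (`exists_sqrt_le_envRegret`) holds for every policy: some action is chosen at
most `3 T / (2 k)` times with probability at least `1 / 3` in the null environment, and making it
better by `√(k / T)` costs the policy the claimed regret.

*The bound for limited switching* (`exists_div_sq_le_envRegret`). Let `m = phaseIndex k S`, so that
there are at most `(m + 1) (k - 1)` switches, and divide an initial part of the horizon into `m + 1`
windows `[n j, n (j + 1))`. Taking all `k` actions in a window requires `k - 1` switches. Hence
either some action `i` is left out of some window `j`, or the switches are exhausted when the last
action `i` to be discovered in window `m` is first taken there (`exists_discoversAt`), and the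
policy is stuck with it. One of these `k (m + 2)` events has probability at least
`1 / (k (m + 2))` in the null environment. Each involves at most `n j + 1` choices of `i` with
`j ≤ m`, so it remains likely when `i` is made better, respectively worse, by about
`1 / √(n j + 1)`; the policy then loses this much in each round of window `j`, respectively in each
round after the windows. Choosing the `n j` such that `n (j + 1) / √(n j + 1)` is of the same order
for all `j` gives the rate `T ^ (1 / (2 - 2 ^ (-m)))` (`exists_pow_le_envRegret`), as long as consecutive `n j`
are well separated; otherwise this rate is of order `√T`, and the first bound suffices. Since the
exponent of `T` is at least `1 / 2`, the factor `k ^ (-2)` that this argument yields is at least the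
required power of `k`.
-/

open MeasureTheory ProbabilityTheory
open scoped NNReal ENNReal

namespace Bandit

/-! ### Switches of a sequence of actions -/

section Switches

variable {α : Type*}

/-- Whether a sequence has the property `Q` depends on its first `n` terms only. -/
def DependsOnFirst (n : ℕ) (Q : (ℕ → α) → Prop) : Prop :=
  ∀ a b : ℕ → α, (∀ t < n, a t = b t) → Q a → Q b

theorem DependsOnFirst.mono {n n' : ℕ} {Q : (ℕ → α) → Prop} (hQ : DependsOnFirst n Q)
    (hn : n ≤ n') : DependsOnFirst n' Q := fun a b hab => hQ a b fun t ht => hab t (ht.trans_le hn)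

variable [DecidableEq α]

/-- The times `t` in `[u, v)` at which the sequence `a` switches, that is, `a t ≠ a (t + 1)`. -/
def switchTimes (a : ℕ → α) (u v : ℕ) : Finset ℕ :=
  (Finset.Ico u v).filter fun t => a t ≠ a (t + 1)

theorem eq_of_switchTimes_eq_empty {a : ℕ → α} {u v : ℕ} (h : switchTimes a u v = ∅)
    {t : ℕ} (hut : u ≤ t) (htv : t ≤ v) : a t = a u := by
  induction t, hut using Nat.le_induction with
  | base => rfl
  | succ t hut ih =>
    rw [← ih (by omega)]
    by_contra hne
    have : t ∈ switchTimes a u v := by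
      simp only [switchTimes, Finset.mem_filter, Finset.mem_Ico]
      exact ⟨⟨hut, by omega⟩, fun h => hne h.symm⟩
    simp [h] at this

theorem card_switchTimes_add (a : ℕ → α) {u v w : ℕ} (huv : u ≤ v) (hvw : v ≤ w) :
    (switchTimes a u v).card + (switchTimes a v w).card = (switchTimes a u w).card := by
  unfold switchTimes
  rw [← Finset.Ico_union_Ico_eq_Ico huv hvw, Finset.filter_union, Finset.card_union_of_disjoint]
  exact Finset.disjoint_filter_filter (Finset.Ico_disjoint_Ico_consecutive u v w)

/-- Every value other than `a u` is entered by a switch, so a sequence that takes all values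
during `[u, v]` switches at least `card α - 1` times there. -/
theorem card_sub_one_le_card_switchTimes [Fintype α] {a : ℕ → α} {u v : ℕ}
    (h : ∀ b, ∃ t, u ≤ t ∧ t ≤ v ∧ a t = b) :
    Fintype.card α - 1 ≤ (switchTimes a u v).card := by
  have hsub : Finset.univ.erase (a u) ⊆ (switchTimes a u v).image fun t => a (t + 1) := by
    intro b hb
    have hne : b ≠ a u := Finset.ne_of_mem_erase hb
    have hex := h b
    obtain ⟨hut, htv, hab⟩ := Nat.find_spec hex
    have hmin := fun s => Nat.find_min (m := s) hex
    set t := Nat.find hex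
    have hlt : u < t := lt_of_le_of_ne hut fun he => hne (by rw [← hab, ← he])
    have hpred : a (t - 1) ≠ b := fun he =>
      hmin (t - 1) (by omega) ⟨by omega, by omega, he⟩
    refine Finset.mem_image.2 ⟨t - 1, ?_, ?_⟩
    · simp only [switchTimes, Finset.mem_filter, Finset.mem_Ico]
      rw [Nat.sub_add_cancel (by omega), hab]
      exact ⟨⟨by omega, by omega⟩, hpred⟩
    · rw [Nat.sub_add_cancel (by omega), hab]
  calc Fintype.card α - 1 = (Finset.univ.erase (a u)).card := by
        rw [Finset.card_erase_of_mem (Finset.mem_univ _), Finset.card_univ]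
    _ ≤ _ := (Finset.card_le_card hsub).trans Finset.card_image_le

theorem mul_card_sub_one_le_card_switchTimes [Fintype α] {a : ℕ → α} {n : ℕ → ℕ}
    (hn : Monotone n) (m : ℕ) (h : ∀ j < m, ∀ b, ∃ t, n j ≤ t ∧ t < n (j + 1) ∧ a t = b) :
    m * (Fintype.card α - 1) ≤ (switchTimes a (n 0) (n m)).card := by
  induction m with
  | zero => simp
  | succ m ih =>
    have h1 := ih fun j hj => h j (by omega)
    have h2 : Fintype.card α - 1 ≤ (switchTimes a (n m) (n (m + 1))).card :=
      card_sub_one_le_card_switchTimes fun b => by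
        obtain ⟨t, h1, h2, h3⟩ := h m (by omega) b
        exact ⟨t, h1, h2.le, h3⟩
    rw [← card_switchTimes_add a (hn (Nat.zero_le m)) (hn (Nat.le_succ m)), add_mul, one_mul]
    exact add_le_add h1 h2

/-- The action `b` is first taken at time `s` since time `u`, and at least `r` switches have been
made by then. -/
def DiscoversAt (a : ℕ → α) (u r : ℕ) (b : α) (s : ℕ) : Prop :=
  a s = b ∧ (∀ t, u ≤ t → t < s → a t ≠ b) ∧ r ≤ (switchTimes a 0 s).card

/-- If all actions are taken in each of the `m + 1` windows `[n j, n (j + 1))`, then the last action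
to be discovered in the last window is discovered after at least `(m + 1) (card α - 1)` switches. -/
theorem exists_discoversAt [Fintype α] [Nonempty α] {a : ℕ → α} {n : ℕ → ℕ} (hn : Monotone n)
    (h0 : n 0 = 0)
    (m : ℕ) (h : ∀ j < m + 1, ∀ b, ∃ t, n j ≤ t ∧ t < n (j + 1) ∧ a t = b) :
    ∃ b s, n m ≤ s ∧ s < n (m + 1) ∧ DiscoversAt a (n m) ((m + 1) * (Fintype.card α - 1)) b s := by
  have hm := h m (by omega)
  let f : α → ℕ := fun b => Nat.find (hm b)
  obtain ⟨b, -, hb⟩ := Finset.exists_max_image Finset.univ f Finset.univ_nonempty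
  obtain ⟨h1, h2, h3⟩ := Nat.find_spec (hm b)
  refine ⟨b, f b, h1, h2, h3, fun t ht htf hab => ?_, ?_⟩
  · exact Nat.find_min (hm b) htf ⟨ht, htf.trans h2, hab⟩
  · have hfirst := mul_card_sub_one_le_card_switchTimes hn m fun j hj => h j (by omega)
    have hlast : Fintype.card α - 1 ≤ (switchTimes a (n m) (f b)).card :=
      card_sub_one_le_card_switchTimes fun c => by
        obtain ⟨g1, -, g3⟩ := Nat.find_spec (hm c)
        exact ⟨f c, g1, hb c (Finset.mem_univ _), g3⟩
    rw [h0] at hfirst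
    rw [← card_switchTimes_add a (Nat.zero_le (n m)) h1, add_mul, one_mul]
    exact add_le_add hfirst hlast

theorem dependsOnFirst_discoversAt (u r : ℕ) (b : α) (s : ℕ) :
    DependsOnFirst (s + 1) fun a => DiscoversAt a u r b s := by
  rintro a a' haa ⟨h1, h2, h3⟩
  refine ⟨haa s (by omega) ▸ h1, fun t hut hts => haa t (by omega) ▸ h2 t hut hts, ?_⟩
  have : switchTimes a' 0 s = switchTimes a 0 s := by
    refine Finset.filter_congr fun t ht => ?_
    have := (Finset.mem_Ico.1 ht).2
    rw [haa t (by omega), haa (t + 1) (by omega)]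
  rwa [this]

end Switches

/-! ### The sequence of actions of a history -/

section Actions

variable {k : ℕ} [NeZero k]

/-- The sequence of actions of a history, continued by the action `0` after its last round. -/
def actions {n : ℕ} (h : History k n) (t : ℕ) : Fin k := if ht : t < n then (h ⟨t, ht⟩).1 else 0

theorem actions_of_lt {n : ℕ} (h : History k n) {t : ℕ} (ht : t < n) :
    actions h t = (h ⟨t, ht⟩).1 := dif_pos ht

theorem actions_appendRound_of_lt {n : ℕ} (p : History k n × (Fin k × ℝ)) {t : ℕ} (ht : t < n) :
    actions (appendRound p) t = actions p.1 t := by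
  rw [actions_of_lt _ ht, actions_of_lt _ (ht.trans (Nat.lt_succ_self n))]
  exact congrArg Prod.fst (Fin.snoc_castSucc (α := fun _ => Fin k × ℝ) p.2 p.1 ⟨t, ht⟩)

theorem measurableSet_actions {n : ℕ} (Q : (ℕ → Fin k) → Prop) :
    MeasurableSet {h : History k n | Q (actions h)} := by
  have hm : Measurable fun (h : History k n) (t : Fin n) => (h t).1 :=
    measurable_pi_lambda _ fun t => measurable_fst.comp (measurable_pi_apply t)
  exact hm (MeasurableSet.of_discrete (s := {c : Fin n → Fin k |
    Q fun t => if ht : t < n then c ⟨t, ht⟩ else 0}))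

theorem switchCount_eq_card_switchTimes {T : ℕ} (h : History k T) :
    Policy.switchCount h = (switchTimes (actions h) 0 (T - 1)).card := by
  unfold Policy.switchCount switchTimes
  refine Finset.card_bij (fun t _ => (t : ℕ)) ?_ (fun _ _ _ _ h => Fin.ext h) ?_
  · rintro t ht
    obtain ⟨ht1, ht2⟩ := (Finset.mem_filter.1 ht).2
    rw [Finset.mem_filter, Finset.mem_Ico, actions_of_lt h t.2, actions_of_lt h ht1]
    exact ⟨⟨Nat.zero_le _, by omega⟩, ht2⟩
  · intro t ht
    obtain ⟨ht1, ht2⟩ := Finset.mem_filter.1 ht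
    rw [Finset.mem_Ico] at ht1
    rw [actions_of_lt h (show t < T by omega), actions_of_lt h (show t + 1 < T by omega)] at ht2
    exact ⟨⟨t, by omega⟩, Finset.mem_filter.2 ⟨Finset.mem_univ _, by simp; omega, ht2⟩, rfl⟩

end Actions

/-! ### Gaussian environments -/

theorem hasSubgaussianMGF_sub_gaussianReal (μ : ℝ) :
    HasSubgaussianMGF (fun x => x - μ) 1 (gaussianReal μ 1) := by
  have hmap : (gaussianReal μ 1).map (fun x => x - μ) = gaussianReal 0 1 := by
    rw [gaussianReal_map_sub_const, sub_self]
  refine ⟨fun t => ?_, fun t => ?_⟩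
  · have h := (integrable_exp_mul_gaussianReal (μ := μ) (v := 1) t).mul_const (Real.exp (-(t * μ)))
    refine h.congr (Filter.Eventually.of_forall fun x => ?_)
    simp only
    rw [← Real.exp_add]
    congr 1
    ring
  · rw [mgf_gaussianReal hmap]
    simp

/-- The environment in which the rewards of action `i` are Gaussian with mean `μ i` and
variance `1`. -/
noncomputable def gaussianEnv {k : ℕ} (μ : Fin k → ℝ) (hμ : ∀ i j, |μ i - μ j| ≤ 1) : Env k where
  dist i := gaussianReal (μ i) 1
  isProbabilityMeasure_dist i := inferInstance
  subgaussian i := by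
    simpa only [integral_id_gaussianReal] using hasSubgaussianMGF_sub_gaussianReal (μ i)
  gap_le_one i j := by simpa only [integral_id_gaussianReal] using hμ i j

theorem mean_le_bestMean {k : ℕ} (D : Env k) (i : Fin k) : D.mean i ≤ D.bestMean :=
  le_ciSup (Set.finite_range _).bddAbove i

theorem mean_gaussianEnv {k : ℕ} (μ : Fin k → ℝ) (hμ : ∀ i j, |μ i - μ j| ≤ 1) (i : Fin k) :
    (gaussianEnv μ hμ).mean i = μ i :=
  integral_id_gaussianReal

/-- The environment in which all rewards are standard Gaussian. -/
noncomputable def nullEnv (k : ℕ) : Env k := gaussianEnv 0 (by simp)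

/-- The environment in which the rewards of action `i` have mean `δ`, those of all other actions
have mean `0`, and all of them are Gaussian with variance `1`. -/
noncomputable def singleEnv {k : ℕ} (i : Fin k) {δ : ℝ} (hδ : |δ| ≤ 1) : Env k :=
  gaussianEnv (Pi.single i δ) fun a b => by
    by_cases ha : a = i <;> by_cases hb : b = i <;> simp [ha, hb, hδ]

theorem mean_singleEnv {k : ℕ} (i : Fin k) {δ : ℝ} (hδ : |δ| ≤ 1) (a : Fin k) :
    (singleEnv i hδ).mean a = if a = i then δ else 0 := by
  rw [singleEnv, mean_gaussianEnv, Pi.single_apply]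

theorem lintegral_gaussianReal_eq (μ : ℝ) {f : ℝ → ℝ≥0∞} (hf : Measurable f) :
    ∫⁻ x, f x ∂gaussianReal μ 1 =
      ∫⁻ x, f x * ENNReal.ofReal (Real.exp (μ * x - μ ^ 2 / 2)) ∂gaussianReal 0 1 := by
  have hfE : Measurable fun x : ℝ => f x * ENNReal.ofReal (Real.exp (μ * x - μ ^ 2 / 2)) := by
    fun_prop
  rw [gaussianReal_of_var_ne_zero _ one_ne_zero, gaussianReal_of_var_ne_zero _ one_ne_zero,
    lintegral_withDensity_eq_lintegral_mul _ (measurable_gaussianPDF _ _) hf,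
    lintegral_withDensity_eq_lintegral_mul _ (measurable_gaussianPDF _ _) hfE]
  refine lintegral_congr fun x => ?_
  simp only [Pi.mul_apply]
  have : gaussianPDF μ 1 x
      = gaussianPDF 0 1 x * ENNReal.ofReal (Real.exp (μ * x - μ ^ 2 / 2)) := by
    unfold gaussianPDF
    rw [← ENNReal.ofReal_mul (gaussianPDFReal_nonneg _ _ _)]
    congr 1
    unfold gaussianPDFReal
    rw [mul_assoc _ (Real.exp _), ← Real.exp_add]
    congr 2
    push_cast
    ring
  rw [this]
  ring

/-! ### The law of the history -/

section Law

variable {k : ℕ} (π : Policy k)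

theorem measurable_lintegral_stepKernel (D : Env k) {n : ℕ} {f : History k (n + 1) → ℝ≥0∞}
    (hf : Measurable f) :
    Measurable fun h => ∫⁻ p, f (appendRound (h, p)) ∂π.stepKernel D n h :=
  (hf.comp measurable_appendRound).lintegral_kernel_prod_right'

theorem lintegral_law_succ (D : Env k) {n : ℕ} {f : History k (n + 1) → ℝ≥0∞}
    (hf : Measurable f) :
    ∫⁻ h, f h ∂π.law D (n + 1) =
      ∫⁻ h, ∫⁻ p, f (appendRound (h, p)) ∂π.stepKernel D n h ∂π.law D n := by
  change ∫⁻ h, f h ∂((π.law D n) ⊗ₘ (π.stepKernel D n)).map appendRound = _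
  rw [lintegral_map hf measurable_appendRound]
  exact Measure.lintegral_compProd (hf.comp measurable_appendRound)

theorem lintegral_stepKernel (D : Env k) {n : ℕ} (h : History k n)
    {f : History k (n + 1) → ℝ≥0∞} (hf : Measurable f) :
    ∫⁻ p, f (appendRound (h, p)) ∂π.stepKernel D n h =
      ∫⁻ a, ∫⁻ x, f (appendRound (h, (a, x))) ∂D.dist a ∂π.kernel n h :=
  Kernel.lintegral_compProd _ _ _
    (hf.comp (measurable_appendRound.comp (measurable_prodMk_left (x := h))))

/-- The logarithm of the likelihood ratio of a history between the Gaussian environment with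
means `μ` and the one with means `0`. -/
noncomputable def logLikelihood (μ : Fin k → ℝ) {n : ℕ} (h : History k n) : ℝ :=
  ∑ t, (μ (h t).1 * (h t).2 - μ (h t).1 ^ 2 / 2)

theorem measurable_logLikelihood (μ : Fin k → ℝ) (n : ℕ) :
    Measurable (logLikelihood μ : History k n → ℝ) := by
  have hμ : Measurable μ := Measurable.of_discrete
  unfold logLikelihood
  fun_prop

theorem logLikelihood_appendRound (μ : Fin k → ℝ) {n : ℕ} (h : History k n) (a : Fin k) (x : ℝ) :
    logLikelihood μ (appendRound (h, (a, x)))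
      = logLikelihood μ h + (μ a * x - μ a ^ 2 / 2) := by
  simp only [logLikelihood, appendRound, Fin.sum_univ_castSucc, Fin.snoc_castSucc, Fin.snoc_last]

/-- The likelihood ratio `exp (logLikelihood μ h)` is the density of the law of the history in a
Gaussian environment with respect to its law in the null environment: the policy's own
randomization does not contribute to it. -/
theorem lintegral_law_gaussianEnv (μ : Fin k → ℝ) (hμ : ∀ i j, |μ i - μ j| ≤ 1)
    (n : ℕ)
    {f : History k n → ℝ≥0∞} (hf : Measurable f) :
    ∫⁻ h, f h ∂π.law (gaussianEnv μ hμ) n =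
      ∫⁻ h, f h * ENNReal.ofReal (Real.exp (logLikelihood μ h)) ∂π.law (nullEnv k) n := by
  induction n with
  | zero => simp [Policy.law, logLikelihood]
  | succ n ih =>
    have hE : ∀ n, Measurable fun h : History k n =>
        ENNReal.ofReal (Real.exp (logLikelihood μ h)) := fun n =>
      ENNReal.measurable_ofReal.comp (Real.measurable_exp.comp (measurable_logLikelihood μ n))
    have hfE : Measurable fun h : History k (n + 1) =>
        f h * ENNReal.ofReal (Real.exp (logLikelihood μ h)) := hf.mul (hE _)
    rw [lintegral_law_succ π _ hf, ih (measurable_lintegral_stepKernel π _ hf),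
      lintegral_law_succ π _ hfE]
    refine lintegral_congr fun h => ?_
    rw [lintegral_stepKernel π _ h hf, lintegral_stepKernel π _ h hfE,
      ← lintegral_mul_const _ Measurable.of_discrete]
    refine lintegral_congr fun a => ?_
    have hfa : Measurable fun x : ℝ => f (appendRound (h, (a, x))) :=
      hf.comp
      (measurable_appendRound.comp (measurable_prodMk_left.comp measurable_prodMk_left))
    change (∫⁻ x, f (appendRound (h, (a, x))) ∂gaussianReal (μ a) 1) * _
      = ∫⁻ x, _ ∂gaussianReal 0 1
    rw [lintegral_gaussianReal_eq _ hfa,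
      ← lintegral_mul_const' _ _ ENNReal.ofReal_ne_top]
    refine lintegral_congr fun x => ?_
    rw [logLikelihood_appendRound, Real.exp_add, ENNReal.ofReal_mul (Real.exp_pos _).le]
    ring

end Law

/-! ### Probabilities of events on the actions, and change of measure -/

section Probabilities

variable {k : ℕ} [NeZero k] (π : Policy k) (D : Env k)

/-- The probability that the actions of the first `n` rounds have the property `Q`. -/
noncomputable def actionProb (n : ℕ) (Q : (ℕ → Fin k) → Prop) : ℝ :=
  (π.law D n).real {h | Q (actions h)}

theorem actionProb_nonneg (n : ℕ) (Q : (ℕ → Fin k) → Prop) : 0 ≤ actionProb π D n Q :=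
  measureReal_nonneg

theorem actionProb_le_one (n : ℕ) (Q : (ℕ → Fin k) → Prop) : actionProb π D n Q ≤ 1 :=
  measureReal_le_one

theorem actionProb_succ {n : ℕ} {Q : (ℕ → Fin k) → Prop} (hQ : DependsOnFirst n Q) :
    actionProb π D (n + 1) Q = actionProb π D n Q := by
  unfold actionProb Measure.real
  congr 1
  change (((π.law D n) ⊗ₘ (π.stepKernel D n)).map appendRound) _ = _
  rw [Measure.map_apply measurable_appendRound (measurableSet_actions Q)]
  conv_rhs => rw [← Measure.fst_compProd (π.law D n) (π.stepKernel D n)]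
  rw [Measure.fst_apply (measurableSet_actions Q)]
  congr 1
  ext p
  have hp := fun t (ht : t < n) => actions_appendRound_of_lt p ht
  exact ⟨hQ _ _ hp, hQ _ _ fun t ht => (hp t ht).symm⟩

theorem actionProb_eq_of_le {n n' : ℕ} {Q : (ℕ → Fin k) → Prop} (hQ : DependsOnFirst n Q)
    (hn : n ≤ n') : actionProb π D n' Q = actionProb π D n Q := by
  induction n', hn using Nat.le_induction with
  | base => rfl
  | succ n' hn ih => rw [actionProb_succ π D (hQ.mono hn), ih]

/-- If almost surely at least `w` of the events `Q i` occur, their probabilities add up to `w` at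
least. -/
theorem le_sum_actionProb {ι : Type*} [Fintype ι] (n : ℕ) (Q : ι → (ℕ → Fin k) → Prop)
    [∀ i a, Decidable (Q i a)] {w : ℝ}
    (h : ∀ᵐ h ∂π.law D n, w ≤ (Finset.univ.filter fun i => Q i (actions h)).card) :
    w ≤ ∑ i, actionProb π D n (Q i) := by
  have hms := fun i => measurableSet_actions (n := n) (Q i)
  have hint : ∀ i ∈ Finset.univ,
      Integrable ({h : History k n | Q i (actions h)}.indicator (1 : History k n → ℝ))
        (π.law D n) := fun i _ => (integrable_const (1 : ℝ)).indicator (hms i)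
  have hsum : ∑ i, actionProb π D n (Q i)
      = ∫ h, ∑ i, {h : History k n | Q i (actions h)}.indicator (1 : History k n → ℝ) h
        ∂π.law D n := by
    rw [integral_finsetSum _ hint]
    exact Finset.sum_congr rfl fun i _ => (integral_indicator_one (hms i)).symm
  rw [hsum]
  calc w = ∫ _, w ∂π.law D n := by simp
    _ ≤ _ := by
      refine integral_mono_ae (integrable_const _) (integrable_finsetSum _ hint) ?_
      filter_upwards [h] with h hh
      simpa [Set.indicator_apply] using hh

theorem exists_le_actionProb {ι : Type*} [Fintype ι] [Nonempty ι] (n : ℕ)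
    (Q : ι → (ℕ → Fin k) → Prop) [∀ i a, Decidable (Q i a)] {w : ℝ}
    (h : ∀ᵐ h ∂π.law D n, w ≤ (Finset.univ.filter fun i => Q i (actions h)).card) :
    ∃ i, w / Fintype.card ι ≤ actionProb π D n (Q i) := by
  have hs := le_sum_actionProb π D n Q h
  obtain ⟨i, -, hi⟩ := Finset.exists_le_of_sum_le (s := (Finset.univ : Finset ι))
    (f := fun _ => w / Fintype.card ι) (g := fun i => actionProb π D n (Q i))
    Finset.univ_nonempty (by
      rw [Finset.sum_const, Finset.card_univ, nsmul_eq_mul, mul_div_cancel₀]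
      · exact hs
      · exact_mod_cast Fintype.card_ne_zero)
  exact ⟨i, hi⟩

/-- An event on which the chosen actions lose at least `c` contributes `c` times its probability to
the regret. -/
theorem mul_actionProb_le_envRegret {T : ℕ} {Q : (ℕ → Fin k) → Prop} {c : ℝ}
    (h : ∀ᵐ h ∂π.law D T, Q (actions h) →
      c ≤ ∑ t ∈ Finset.range T, (D.bestMean - D.mean (actions h t))) :
    c * actionProb π D T Q ≤ π.envRegret D T := by
  have hint : ∀ t ∈ (Finset.univ : Finset (Fin T)),
      Integrable (fun h : History k T => D.mean (h t).1) (π.law D T) := by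
    intro t _
    refine Integrable.of_finite.comp_measurable (μ := π.law D T) (g := D.mean) ?_
    exact measurable_fst.comp (measurable_pi_apply t)
  have hgap : ∀ h : History k T, ∑ t ∈ Finset.range T, (D.bestMean - D.mean (actions h t))
      = T * D.bestMean - ∑ t : Fin T, D.mean (h t).1 := by
    intro h
    rw [Finset.sum_range, Finset.sum_sub_distrib]
    simp [actions_of_lt]
  have heq : π.envRegret D T
      = ∫ h, (T * D.bestMean - ∑ t : Fin T, D.mean (h t).1) ∂π.law D T := by
    rw [integral_sub (integrable_const _) (integrable_finsetSum _ hint)]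
    simp [Policy.envRegret]
  rw [heq, actionProb, ← integral_indicator_one (measurableSet_actions Q), ← integral_const_mul]
  refine integral_mono_ae
    (((integrable_const (1 : ℝ)).indicator (measurableSet_actions Q)).const_mul c)
    ((integrable_const _).sub (integrable_finsetSum _ hint)) ?_
  filter_upwards [h] with h hh
  rw [← hgap]
  by_cases hq : Q (actions h)
  · simpa [Set.indicator_apply, hq] using hh hq
  · simpa [Set.indicator_apply, hq] using
      Finset.sum_nonneg (s := Finset.range T) fun t _ => sub_nonneg.2 (mean_le_bestMean D (actions h t))

theorem logLikelihood_single_add_neg (i : Fin k) (δ : ℝ) {n : ℕ} (h : History k n) :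
    logLikelihood (Pi.single i δ) h + logLikelihood (Pi.single i (-δ)) h
      = -(δ ^ 2 * ((Finset.range n).filter fun t => actions h t = i).card) := by
  rw [logLikelihood, logLikelihood, ← Finset.sum_add_distrib, Finset.card_filter,
    Finset.sum_range, Nat.cast_sum, Finset.mul_sum, ← Finset.sum_neg_distrib]
  refine Finset.sum_congr rfl fun t _ => ?_
  rw [actions_of_lt h t.2]
  by_cases hi : (h t).1 = i
  · simp [hi]; ring
  · simp [hi]

theorem law_singleEnv_eq_setLIntegral (i : Fin k) {δ : ℝ} (hδ : |δ| ≤ 1) (n : ℕ)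
    (Q : (ℕ → Fin k) → Prop) :
    π.law (singleEnv i hδ) n {h | Q (actions h)} =
      ∫⁻ h in {h | Q (actions h)}, ENNReal.ofReal (Real.exp (logLikelihood (Pi.single i δ) h))
        ∂π.law (nullEnv k) n := by
  have hms := measurableSet_actions (n := n) Q
  rw [← lintegral_indicator_one hms, singleEnv,
    lintegral_law_gaussianEnv π _ _ n (measurable_one.indicator hms), ← lintegral_indicator hms]
  refine lintegral_congr fun h => ?_
  by_cases hq : Q (actions h) <;> simp [hq]

/-- Change of measure. The likelihood ratios of the environments with means `δ` and `-δ` for action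
`i` multiply to `exp (- δ ^ 2)` per choice of `i`, so that by the Cauchy-Schwarz inequality an event
on which `i` is chosen at most `N` times is not much less likely in either of them than it is in
the null environment. -/
theorem actionProb_nullEnv_le (i : Fin k) {δ : ℝ} (hδ : |δ| ≤ 1) (hδ' : |-δ| ≤ 1) {n : ℕ}
    {Q : (ℕ → Fin k) → Prop} {N : ℝ}
    (hQ : ∀ a, Q a → (((Finset.range n).filter fun t => a t = i).card : ℝ) ≤ N) :
    actionProb π (nullEnv k) n Q ≤ Real.exp (N * δ ^ 2 / 2) *
      (√(actionProb π (singleEnv i hδ) n Q) * √(actionProb π (singleEnv i hδ') n Q)) := by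
  set A : Set (History k n) := {h | Q (actions h)}
  have hms : MeasurableSet A := measurableSet_actions Q
  let G : ℝ → History k n → ℝ≥0∞ := fun d h =>
    ENNReal.ofReal (Real.exp (logLikelihood (Pi.single i d) h / 2))
  have hG : ∀ d, Measurable (G d) := fun d =>
    ENNReal.measurable_ofReal.comp
      (Real.measurable_exp.comp ((measurable_logLikelihood _ n).div_const 2))
  have hGsq : ∀ {d : ℝ} (hd : |d| ≤ 1),
      ∫⁻ h in A, G d h ^ (2 : ℝ) ∂π.law (nullEnv k) n = π.law (singleEnv i hd) n A := by
    intro d hd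
    rw [law_singleEnv_eq_setLIntegral]
    refine lintegral_congr fun h => ?_
    simp only [G]
    rw [ENNReal.ofReal_rpow_of_nonneg (Real.exp_pos _).le (by norm_num), ← Real.exp_mul]
    congr 2
    ring
  have hpt : ∀ h ∈ A, ENNReal.ofReal (Real.exp (-(N * δ ^ 2 / 2))) ≤ (G δ * G (-δ)) h := by
    intro h hh
    simp only [Pi.mul_apply, G]
    rw [← ENNReal.ofReal_mul (Real.exp_pos _).le, ← Real.exp_add, ← add_div,
      logLikelihood_single_add_neg]
    refine ENNReal.ofReal_le_ofReal (Real.exp_le_exp.2 ?_)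
    have := mul_le_mul_of_nonneg_left (hQ _ hh) (sq_nonneg δ)
    linarith
  have hCS := ENNReal.lintegral_mul_le_Lp_mul_Lq ((π.law (nullEnv k) n).restrict A)
    Real.HolderConjugate.two_two (hG δ).aemeasurable (hG (-δ)).aemeasurable
  rw [hGsq hδ, hGsq hδ'] at hCS
  have hlow : ENNReal.ofReal (Real.exp (-(N * δ ^ 2 / 2))) * π.law (nullEnv k) n A
      ≤ π.law (singleEnv i hδ) n A ^ (1 / 2 : ℝ) * π.law (singleEnv i hδ') n A ^ (1 / 2 : ℝ) :=
    calc _ = ∫⁻ _ in A, ENNReal.ofReal (Real.exp (-(N * δ ^ 2 / 2))) ∂π.law (nullEnv k) n := by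
          rw [setLIntegral_const]
      _ ≤ ∫⁻ h in A, (G δ * G (-δ)) h ∂π.law (nullEnv k) n := setLIntegral_mono' hms hpt
      _ ≤ _ := hCS
  have hreal := ENNReal.toReal_mono (by
    refine ENNReal.mul_ne_top ?_ ?_ <;>
      exact ENNReal.rpow_ne_top_of_nonneg (by norm_num) (measure_ne_top _ _)) hlow
  rw [ENNReal.toReal_mul, ENNReal.toReal_mul, ENNReal.toReal_ofReal (Real.exp_pos _).le,
    ← ENNReal.toReal_rpow, ← ENNReal.toReal_rpow, ← Real.sqrt_eq_rpow, ← Real.sqrt_eq_rpow,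
    Real.exp_neg, inv_mul_le_iff₀ (Real.exp_pos _)] at hreal
  exact hreal

end Probabilities

section LowerBounds

variable {k : ℕ} [NeZero k] (π : Policy k)

theorem actionProb_exists_eq_sum (D : Env k) (n : ℕ) {ι : Type*} (J : Finset ι)
    (Q : ι → (ℕ → Fin k) → Prop)
    (hdisj : ∀ s ∈ J, ∀ s' ∈ J, ∀ a, Q s a → Q s' a → s = s') :
    actionProb π D n (fun a => ∃ s ∈ J, Q s a) = ∑ s ∈ J, actionProb π D n (Q s) := by
  unfold actionProb
  rw [← measureReal_biUnion_finset]
  · congr 1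
    ext h
    simp
  · intro s hs s' hs' hne
    refine Set.disjoint_left.2 fun h h1 h2 => hne (hdisj s hs s' hs' _ h1 h2)
  · exact fun s _ => measurableSet_actions (Q s)

/-- Change of measure for an event that is decided at a stopping time: it occurs if one of the
mutually exclusive events `Q s`, each decided after `len s` rounds, does. The bound involves the
number of choices of `i` up to the decision only. -/
theorem sq_actionProb_mul_exp_le (i : Fin k) {δ : ℝ} (hδ : |δ| ≤ 1) {T : ℕ} {ι : Type*}
    (J : Finset ι) (len : ι → ℕ) (Q : ι → (ℕ → Fin k) → Prop) {N : ℝ}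
    (hlen : ∀ s ∈ J, len s ≤ T) (hdep : ∀ s ∈ J, DependsOnFirst (len s) (Q s))
    (hdisj : ∀ s ∈ J, ∀ s' ∈ J, ∀ a, Q s a → Q s' a → s = s')
    (hQ : ∀ s ∈ J, ∀ a, Q s a →
      (((Finset.range (len s)).filter fun t => a t = i).card : ℝ) ≤ N) :
    actionProb π (nullEnv k) T (fun a => ∃ s ∈ J, Q s a) ^ 2 * Real.exp (-(N * δ ^ 2)) ≤
      actionProb π (singleEnv i hδ) T (fun a => ∃ s ∈ J, Q s a) := by
  have hδ' : |-δ| ≤ 1 := by rwa [abs_neg]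
  set P := fun (D : Env k) => actionProb π D T (fun a => ∃ s ∈ J, Q s a) with hP
  have hsum : ∀ D, P D = ∑ s ∈ J, actionProb π D (len s) (Q s) := fun D => by
    rw [hP]
    simp only
    rw [actionProb_exists_eq_sum π D T J Q hdisj]
    exact Finset.sum_congr rfl fun s hs => actionProb_eq_of_le π D (hdep s hs) (hlen s hs)
  have hmain : P (nullEnv k) ≤ Real.exp (N * δ ^ 2 / 2) * √(P (singleEnv i hδ)) :=
    calc P (nullEnv k) ≤ ∑ s ∈ J, Real.exp (N * δ ^ 2 / 2) *
          (√(actionProb π (singleEnv i hδ) (len s) (Q s)) *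
            √(actionProb π (singleEnv i hδ') (len s) (Q s))) := by
          rw [hsum]
          exact Finset.sum_le_sum fun s hs => actionProb_nullEnv_le π i hδ hδ' (hQ s hs)
      _ ≤ Real.exp (N * δ ^ 2 / 2) * (√(P (singleEnv i hδ)) * √(P (singleEnv i hδ'))) := by
          rw [← Finset.mul_sum, hsum, hsum]
          gcongr
          exact Real.sum_sqrt_mul_sqrt_le J (fun s => actionProb_nonneg _ _ _ _)
            (fun s => actionProb_nonneg _ _ _ _)
      _ ≤ Real.exp (N * δ ^ 2 / 2) * √(P (singleEnv i hδ)) := by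
          gcongr
          exact mul_le_of_le_one_right (Real.sqrt_nonneg _)
            (Real.sqrt_le_one.2 (actionProb_le_one _ _ _ _))
  have hsq : P (nullEnv k) ^ 2 ≤ Real.exp (N * δ ^ 2) * P (singleEnv i hδ) :=
    calc _ ≤ (Real.exp (N * δ ^ 2 / 2) * √(P (singleEnv i hδ))) ^ 2 :=
          pow_le_pow_left₀ (actionProb_nonneg _ _ _ _) hmain 2
      _ = _ := by
          rw [mul_pow, Real.sq_sqrt (actionProb_nonneg _ _ _ _), ← Real.exp_nat_mul]
          congr 2
          push_cast
          ring
  rw [Real.exp_neg, mul_inv_le_iff₀ (Real.exp_pos _), mul_comm]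
  exact hsq

theorem sq_actionProb_mul_exp_le_of_dependsOnFirst (i : Fin k) {δ : ℝ} (hδ : |δ| ≤ 1) {n T : ℕ}
    (hn : n ≤ T) {Q : (ℕ → Fin k) → Prop} (hdep : DependsOnFirst n Q) {N : ℝ}
    (hQ : ∀ a, Q a → (((Finset.range n).filter fun t => a t = i).card : ℝ) ≤ N) :
    actionProb π (nullEnv k) T Q ^ 2 * Real.exp (-(N * δ ^ 2)) ≤
      actionProb π (singleEnv i hδ) T Q := by
  simpa using sq_actionProb_mul_exp_le π i hδ (T := T) ({()} : Finset Unit) (fun _ => n)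
    (fun _ => Q) (N := N) (fun _ _ => hn) (fun _ _ => hdep) (fun _ _ _ _ _ _ _ => rfl)
    (fun _ _ => hQ)

/-! ### Loss in the perturbed environments -/

omit [NeZero k] in
theorem mul_card_ne_le_sum_gap (i : Fin k) {δ : ℝ} (hδ : |δ| ≤ 1) (a : ℕ → Fin k) (T : ℕ) :
    δ * ((Finset.range T).filter fun t => a t ≠ i).card ≤
      ∑ t ∈ Finset.range T, ((singleEnv i hδ).bestMean - (singleEnv i hδ).mean (a t)) := by
  rw [Finset.card_filter, Nat.cast_sum, Finset.mul_sum]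
  refine Finset.sum_le_sum fun t _ => ?_
  have h := mean_le_bestMean (singleEnv i hδ) i
  rw [mean_singleEnv, if_pos rfl] at h
  rw [mean_singleEnv]
  by_cases hi : a t = i <;> simp [hi, h]

omit [NeZero k] in
theorem mul_card_eq_le_sum_gap (hk : 2 ≤ k) (i : Fin k) {δ : ℝ} (hδ : |-δ| ≤ 1)
    (a : ℕ → Fin k) (T : ℕ) :
    δ * ((Finset.range T).filter fun t => a t = i).card ≤
      ∑ t ∈ Finset.range T, ((singleEnv i hδ).bestMean - (singleEnv i hδ).mean (a t)) := by
  have : Nontrivial (Fin k) := Fin.nontrivial_iff_two_le.2 hk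
  obtain ⟨j, hj⟩ := exists_ne i
  rw [Finset.card_filter, Nat.cast_sum, Finset.mul_sum]
  refine Finset.sum_le_sum fun t _ => ?_
  have h := mean_le_bestMean (singleEnv i hδ) j
  rw [mean_singleEnv, if_neg hj] at h
  rw [mean_singleEnv]
  by_cases hi : a t = i <;> simp [hi, h]

/-! ### The bound without switching constraints -/

/-- In every sequence of `T` actions, at least a third of the actions are chosen at most `3 / 2`
times as often as the average one. -/
theorem div_three_le_card_seldom {T : ℕ} (hT : 0 < T) (a : ℕ → Fin k) :
    (k : ℝ) / 3 ≤ (Finset.univ.filter fun i =>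
      (((Finset.range T).filter fun t => a t = i).card : ℝ) ≤ 3 * T / (2 * k)).card := by
  set c : Fin k → ℕ := fun i => ((Finset.range T).filter fun t => a t = i).card
  have hk : (0 : ℝ) < k := by exact_mod_cast NeZero.pos k
  have hTr : (0 : ℝ) < T := by exact_mod_cast hT
  have hsum : ∑ i, c i = T := by
    have := Finset.card_eq_sum_card_fiberwise (s := Finset.range T) (t := Finset.univ) (f := a)
      (fun _ _ => Finset.mem_coe.2 (Finset.mem_univ _))
    rw [Finset.card_range] at this
    exact this.symm
  have hcard := Finset.card_filter_add_card_filter_not (s := (Finset.univ : Finset (Fin k)))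
    (fun i => (c i : ℝ) ≤ 3 * T / (2 * k))
  rw [Finset.card_univ, Fintype.card_fin] at hcard
  set w := (Finset.univ.filter fun i => (c i : ℝ) ≤ 3 * T / (2 * k)).card
  set z := (Finset.univ.filter fun i => ¬ (c i : ℝ) ≤ 3 * T / (2 * k)).card with hz
  have hzT : (z : ℝ) * (3 * T / (2 * k)) ≤ T :=
    calc (z : ℝ) * (3 * T / (2 * k))
        = ∑ _i ∈ Finset.univ.filter fun i => ¬ (c i : ℝ) ≤ 3 * T / (2 * k),
            (3 * (T : ℝ) / (2 * k)) := by
          rw [Finset.sum_const, nsmul_eq_mul]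
      _ ≤ ∑ i ∈ Finset.univ.filter fun i => ¬ (c i : ℝ) ≤ 3 * T / (2 * k), (c i : ℝ) :=
          Finset.sum_le_sum fun i hi => (not_le.1 (Finset.mem_filter.1 hi).2).le
      _ ≤ ∑ i, (c i : ℝ) :=
          Finset.sum_le_sum_of_subset_of_nonneg (Finset.filter_subset _ _)
            fun _ _ _ => Nat.cast_nonneg _
      _ = T := by exact_mod_cast hsum
  have hcard' : (w : ℝ) + z = k := by exact_mod_cast hcard
  rw [mul_div_assoc', div_le_iff₀ (by positivity)] at hzT
  have : 3 * (z : ℝ) ≤ 2 * k := by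
    refine le_of_mul_le_mul_right ?_ hTr
    linarith
  change (k : ℝ) / 3 ≤ w
  linarith

/-- The minimax lower bound of order `√(k T)` holds for every policy. -/
theorem exists_sqrt_le_envRegret (hk : 2 ≤ k) {T : ℕ} (hT : k ≤ T) :
    ∃ D : Env k, Real.exp (-(3 / 2)) / 36 * √(k * T) ≤ π.envRegret D T := by
  classical
  have hkr : (2 : ℝ) ≤ k := by exact_mod_cast hk
  have hTr : (k : ℝ) ≤ T := by exact_mod_cast hT
  have hT0 : (0 : ℝ) < T := by linarith
  have hk0 : (0 : ℝ) < k := by linarith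
  set δ : ℝ := √(k / T)
  have hδ0 : 0 ≤ δ := Real.sqrt_nonneg _
  have hδ : |δ| ≤ 1 := by
    rw [abs_of_nonneg hδ0]
    exact Real.sqrt_le_one.2 ((div_le_one hT0).2 hTr)
  have hδsq : δ ^ 2 = k / T := Real.sq_sqrt (by positivity)
  have hδT : δ * T = √(k * T) := by
    refine ((Real.sqrt_eq_iff_mul_self_eq (by positivity) (by positivity)).2 ?_).symm
    symm
    calc δ * T * (δ * T) = δ ^ 2 * T * T := by ring
      _ = k * T := by rw [hδsq]; field_simp
  let Q : Fin k → (ℕ → Fin k) → Prop := fun i a =>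
    (((Finset.range T).filter fun t => a t = i).card : ℝ) ≤ 3 * T / (2 * k)
  obtain ⟨i, hi⟩ := exists_le_actionProb π (nullEnv k) T Q (w := k / 3)
    (Filter.Eventually.of_forall fun h => div_three_le_card_seldom (by omega) (actions h))
  have hp : (1 : ℝ) / 3 ≤ actionProb π (nullEnv k) T (Q i) := by
    refine le_trans (le_of_eq ?_) hi
    rw [Fintype.card_fin]
    field_simp
  have hdep : DependsOnFirst T (Q i) := by
    intro a b hab ha
    have : (Finset.range T).filter (fun t => b t = i)
        = (Finset.range T).filter fun t => a t = i :=
      Finset.filter_congr fun t ht => by rw [hab t (Finset.mem_range.1 ht)]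
    simp only [Q] at ha ⊢
    rwa [this]
  have hchange := sq_actionProb_mul_exp_le_of_dependsOnFirst π i hδ le_rfl hdep fun a ha => ha
  have hexp : 3 * (T : ℝ) / (2 * k) * δ ^ 2 = 3 / 2 := by
    rw [hδsq]
    field_simp
  rw [hexp] at hchange
  refine ⟨singleEnv i hδ, ?_⟩
  have hreg : δ * (T / 4) * actionProb π (singleEnv i hδ) T (Q i) ≤
      π.envRegret (singleEnv i hδ) T := by
    refine mul_actionProb_le_envRegret π _ (Filter.Eventually.of_forall fun h hh => ?_)
    refine le_trans ?_ (mul_card_ne_le_sum_gap i hδ (actions h) T)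
    have hcard := Finset.card_filter_add_card_filter_not (s := Finset.range T)
      (fun t => actions h t = i)
    rw [Finset.card_range] at hcard
    have hcard' : (((Finset.range T).filter fun t => actions h t = i).card : ℝ)
        + ((Finset.range T).filter fun t => actions h t ≠ i).card = T := by exact_mod_cast hcard
    have hN : 3 * (T : ℝ) / (2 * k) ≤ 3 * T / 4 := by
      rw [div_le_div_iff₀ (by positivity) (by norm_num)]
      nlinarith
    have hh' : (((Finset.range T).filter fun t => actions h t = i).card : ℝ)
      ≤ 3 * T / (2 * k) := hh
    gcongr
    linarith
  refine le_trans ?_ hreg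
  have hp2 : (1 : ℝ) / 9 ≤ actionProb π (nullEnv k) T (Q i) ^ 2 := by nlinarith
  calc Real.exp (-(3 / 2)) / 36 * √(k * T)
      = δ * (T / 4) * (1 / 9 * Real.exp (-(3 / 2))) := by rw [← hδT]; ring
    _ ≤ δ * (T / 4) * (actionProb π (nullEnv k) T (Q i) ^ 2 * Real.exp (-(3 / 2))) := by gcongr
    _ ≤ _ := by gcongr

end LowerBounds

/-! ### The bound with switching constraints -/

theorem card_filter_range_le_of_forall_ne {α : Type*} [DecidableEq α] {a : ℕ → α} {i : α}
    {u v : ℕ} (h : ∀ t, u ≤ t → t < v → a t ≠ i) :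
    ((Finset.range v).filter fun t => a t = i).card ≤ u := by
  calc _ ≤ (Finset.range u).card := by
        refine Finset.card_le_card fun t ht => ?_
        obtain ⟨ht1, ht2⟩ := Finset.mem_filter.1 ht
        rw [Finset.mem_range] at ht1 ⊢
        by_contra hut
        exact h t (not_lt.1 hut) ht1 ht2
    _ = u := Finset.card_range u

section Phases

variable {k : ℕ} [NeZero k] (π : Policy k)

/-- If an action is likely to be left out of the rounds `[u, v)` in the null environment, then
the regret is large when this action is better than the others: nothing has been learnt about it
after round `u`. -/
theorem mul_sq_le_envRegret_of_avoids (i : Fin k) {δ : ℝ} (hδ0 : 0 ≤ δ) (hδ : |δ| ≤ 1)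
    {u v T : ℕ} (huv : u ≤ v) (hvT : v ≤ T) :
    δ * (v - u) * (actionProb π (nullEnv k) T (fun a => ∀ t, u ≤ t → t < v → a t ≠ i) ^ 2 *
      Real.exp (-(u * δ ^ 2))) ≤ π.envRegret (singleEnv i hδ) T := by
  have huv' : (u : ℝ) ≤ v := by exact_mod_cast huv
  have hdep : DependsOnFirst v fun a : ℕ → Fin k => ∀ t, u ≤ t → t < v → a t ≠ i :=
    fun a b hab ha t hut htv => hab t htv ▸ ha t hut htv
  have hchange := sq_actionProb_mul_exp_le_of_dependsOnFirst π i hδ hvT hdep (N := u)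
    fun a ha => by exact_mod_cast card_filter_range_le_of_forall_ne ha
  refine le_trans (mul_le_mul_of_nonneg_left hchange (mul_nonneg hδ0 (sub_nonneg.2 huv'))) ?_
  refine mul_actionProb_le_envRegret π _ (Filter.Eventually.of_forall fun h hh => ?_)
  refine le_trans (mul_le_mul_of_nonneg_left ?_ hδ0) (mul_card_ne_le_sum_gap i hδ (actions h) T)
  rw [← Nat.cast_sub huv, Nat.cast_le, ← Nat.card_Ico]
  refine Finset.card_le_card fun t ht => ?_
  obtain ⟨ht1, ht2⟩ := Finset.mem_Ico.1 ht
  exact Finset.mem_filter.2 ⟨Finset.mem_range.2 (by omega), hh t ht1 ht2⟩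

/-- If, in the null environment, a policy with at most `r` switches is likely to have made `r` of
them by the time it first takes action `i` in the rounds `[u, v)`, then the regret is large when
this action is worse than the others: the policy is stuck with `i`, about which it had learnt
nothing between round `u` and that time. -/
theorem mul_sq_le_envRegret_of_discovers (hk : 2 ≤ k) (i : Fin k) {δ : ℝ} (hδ0 : 0 ≤ δ)
    (hδ : |-δ| ≤ 1) {u v r S T : ℕ} (hvT : v ≤ T) (hSr : S ≤ r) (hπ : π.IsSwitchPolicy S T) :
    δ * (T - v) * (actionProb π (nullEnv k) T
        (fun a => ∃ s ∈ Finset.Ico u v, DiscoversAt a u r i s) ^ 2 *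
      Real.exp (-((u + 1) * δ ^ 2))) ≤ π.envRegret (singleEnv i hδ) T := by
  have hvT' : (v : ℝ) ≤ T := by exact_mod_cast hvT
  have hchange := sq_actionProb_mul_exp_le π i hδ (T := T) (Finset.Ico u v) (fun s => s + 1)
    (fun s a => DiscoversAt a u r i s) (N := u + 1)
    (fun s hs => by have := Finset.mem_Ico.1 hs; omega)
    (fun s _ => dependsOnFirst_discoversAt u r i s)
    (fun s hs s' hs' a h h' => by
      have hs1 := (Finset.mem_Ico.1 hs).1
      have hs1' := (Finset.mem_Ico.1 hs').1
      rcases lt_trichotomy s s' with hlt | heq | hlt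
      · exact absurd h.1 (h'.2.1 s hs1 hlt)
      · exact heq
      · exact absurd h'.1 (h.2.1 s' hs1' hlt))
    (fun s _ a h => by
      rw [Finset.range_add_one, Finset.filter_insert, if_pos h.1,
        Finset.card_insert_of_notMem (by simp)]
      have := card_filter_range_le_of_forall_ne h.2.1
      exact_mod_cast Nat.succ_le_succ this)
  rw [neg_sq] at hchange
  refine le_trans (mul_le_mul_of_nonneg_left hchange (mul_nonneg hδ0 (sub_nonneg.2 hvT'))) ?_
  refine mul_actionProb_le_envRegret π _ ?_
  filter_upwards [hπ (singleEnv i hδ)] with h hsw hh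
  obtain ⟨s, hs, hsi, -, hr⟩ := hh
  obtain ⟨-, hsv⟩ := Finset.mem_Ico.1 hs
  rw [switchCount_eq_card_switchTimes,
    ← card_switchTimes_add _ (Nat.zero_le s) (show s ≤ T - 1 by omega)] at hsw
  have hempty : switchTimes (actions h) s (T - 1) = ∅ := Finset.card_eq_zero.1 (by omega)
  refine le_trans (mul_le_mul_of_nonneg_left ?_ hδ0) (mul_card_eq_le_sum_gap hk i hδ (actions h) T)
  rw [← Nat.cast_sub hvT, Nat.cast_le, ← Nat.card_Ico]
  refine Finset.card_le_card fun t ht => ?_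
  obtain ⟨ht1, ht2⟩ := Finset.mem_Ico.1 ht
  refine Finset.mem_filter.2 ⟨Finset.mem_range.2 ht2, ?_⟩
  rw [eq_of_switchTimes_eq_empty hempty (show s ≤ t by omega) (by omega), hsi]

/-- The lower bound for an arbitrary division of the horizon into `m + 1` windows and a final
period, with a gap `δ j` of the means that is too small to be noticed during the `n j` rounds
before window `j`. -/
theorem exists_div_sq_le_envRegret (hk : 2 ≤ k) {m S T : ℕ} (hS : S ≤ (m + 1) * (k - 1))
    (hπ : π.IsSwitchPolicy S T) {n : ℕ → ℕ} (hn : Monotone n) (h0 : n 0 = 0)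
    (hnT : n (m + 1) ≤ T) {δ : ℕ → ℝ} {c : ℝ} (hδ0 : ∀ j ≤ m, 0 ≤ δ j) (hδ1 : ∀ j ≤ m, δ j ≤ 1)
    (hδn : ∀ j ≤ m, ((n j : ℝ) + 1) * δ j ^ 2 ≤ 2)
    (hwin : ∀ j ≤ m, c ≤ δ j * ((n (j + 1) : ℝ) - n j))
    (hfin : c ≤ δ m * ((T : ℝ) - n (m + 1))) :
    ∃ D : Env k, c * ((1 / (k * (m + 2) : ℝ)) ^ 2 * Real.exp (-2)) ≤ π.envRegret D T := by
  classical
  let Q : Fin (m + 1) × Fin k ⊕ Fin k → (ℕ → Fin k) → Prop := Sum.elim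
    (fun p a => ∀ t, n p.1 ≤ t → t < n (p.1 + 1) → a t ≠ p.2)
    (fun i a => ∃ s ∈ Finset.Ico (n m) (n (m + 1)),
      DiscoversAt a (n m) ((m + 1) * (k - 1)) i s)
  have hcover : ∀ a : ℕ → Fin k, ∃ x, Q x a := by
    intro a
    by_contra hnone
    have hwin' : ∀ j < m + 1, ∀ b, ∃ t, n j ≤ t ∧ t < n (j + 1) ∧ a t = b := by
      intro j hj b
      by_contra hno
      exact hnone ⟨Sum.inl (⟨j, hj⟩, b), fun t h1 h2 h3 => hno ⟨t, h1, h2, h3⟩⟩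
    obtain ⟨b, s, h1, h2, h3⟩ := exists_discoversAt hn h0 m hwin'
    rw [Fintype.card_fin] at h3
    exact hnone ⟨Sum.inr b, s, Finset.mem_Ico.2 ⟨h1, h2⟩, h3⟩
  obtain ⟨x, hx⟩ := exists_le_actionProb π (nullEnv k) T Q (w := 1)
    (Filter.Eventually.of_forall fun h => by
      obtain ⟨x, hx⟩ := hcover (actions h)
      exact_mod_cast Finset.card_pos.2 ⟨x, Finset.mem_filter.2 ⟨Finset.mem_univ _, hx⟩⟩)
  have hcard : (Fintype.card (Fin (m + 1) × Fin k ⊕ Fin k) : ℝ) = k * (m + 2) := by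
    simp only [Fintype.card_sum, Fintype.card_prod, Fintype.card_fin]
    push_cast
    ring
  rw [hcard] at hx
  have hfac : ∀ j ≤ m, ∀ e : ℝ, e ≤ (n j + 1) * δ j ^ 2 → ∀ b, c ≤ b → 0 ≤ b →
      c * ((1 / (k * (m + 2) : ℝ)) ^ 2 * Real.exp (-2)) ≤
        b * (actionProb π (nullEnv k) T (Q x) ^ 2 * Real.exp (-e)) := by
    intro j hj e he b hcb hb
    have : -2 ≤ -e := by linarith [hδn j hj]
    gcongr
  cases x with
  | inl p =>
    obtain ⟨j, i⟩ := p
    have hj : (j : ℕ) ≤ m := by omega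
    have hmono : n j ≤ n (j + 1) := hn (Nat.le_succ _)
    have hmono' : (n j : ℝ) ≤ n (j + 1) := by exact_mod_cast hmono
    have hδ : |δ j| ≤ 1 := by rw [abs_of_nonneg (hδ0 j hj)]; exact hδ1 j hj
    refine ⟨singleEnv i hδ, le_trans ?_ (mul_sq_le_envRegret_of_avoids π i (hδ0 j hj) hδ hmono
      ((hn (by omega)).trans hnT))⟩
    exact hfac j hj _ (by nlinarith [sq_nonneg (δ j)]) _ (hwin j hj)
      (mul_nonneg (hδ0 j hj) (sub_nonneg.2 hmono'))
  | inr i =>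
    have hδ : |-δ m| ≤ 1 := by rw [abs_neg, abs_of_nonneg (hδ0 m le_rfl)]; exact hδ1 m le_rfl
    have hnT' : (n (m + 1) : ℝ) ≤ T := by exact_mod_cast hnT
    refine ⟨singleEnv i hδ, le_trans ?_ (mul_sq_le_envRegret_of_discovers π hk i (hδ0 m le_rfl) hδ
      (u := n m) hnT hS hπ)⟩
    exact hfac m le_rfl _ le_rfl _ hfin (mul_nonneg (hδ0 m le_rfl) (sub_nonneg.2 hnT'))

/-- With windows that end at `q ^ (2 ^ (m + 1) - 2 ^ (m - j)) / 2` for `j ≤ m`, where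
`T = q ^ (2 ^ (m + 1) - 1)`, all of them lead to the same bound, of order `q ^ 2 ^ m`. -/
theorem exists_pow_le_envRegret (hk : 2 ≤ k) {m S T : ℕ} (hS : S ≤ (m + 1) * (k - 1))
    (hπ : π.IsSwitchPolicy S T) {q : ℝ} (hq : 8 ≤ q) (hqT : q ^ (2 ^ (m + 1) - 1) = T) :
    ∃ D : Env k, q ^ 2 ^ m / 4 * ((1 / (k * (m + 2) : ℝ)) ^ 2 * Real.exp (-2)) ≤
      π.envRegret D T := by
  have hq1 : 1 ≤ q := by linarith
  have hq0 : 0 < q := by linarith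
  let t : ℕ → ℝ := fun j => q ^ (2 ^ (m + 1) - 2 ^ (m + 1 - j))
  -- Halving leaves the second half of the horizon for the final period, and makes `n 0 = 0`.
  let n : ℕ → ℕ := fun j => ⌊t j / 2⌋₊
  -- The gap at phase `j` is the inverse of `u j = √(t j)`.
  let u : ℕ → ℝ := fun j => q ^ (2 ^ m - 2 ^ (m - j))
  have hu1 : ∀ j, 1 ≤ u j := fun j => one_le_pow₀ hq1
  have hpow : ∀ j ≤ m, 2 ^ (m + 1 - j) = 2 * 2 ^ (m - j) ∧ 2 ^ (m - j) ≤ 2 ^ m := fun j hj => by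
    rw [Nat.sub_add_comm hj, pow_succ, mul_comm]
    exact ⟨rfl, Nat.pow_le_pow_right (by norm_num) (Nat.sub_le m j)⟩
  have htu : ∀ j ≤ m, t j = u j ^ 2 := fun j hj => by
    simp only [t, u]
    rw [← pow_mul, (hpow j hj).1, pow_succ]
    congr 1
    omega
  have htR : ∀ j ≤ m, t (j + 1) = q ^ 2 ^ m * u j := fun j hj => by
    simp only [t, u]
    rw [← pow_add, Nat.add_sub_add_right, pow_succ]
    congr 1
    have := (hpow j hj).2
    omega
  -- Equivalently `8 * t j ≤ t (j + 1)`, so that windows are long despite the rounding in `n`.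
  have hRu : ∀ j ≤ m, 8 * u j ≤ q ^ 2 ^ m := fun j hj => by
    have h1 : q ^ 2 ^ m = q ^ 2 ^ (m - j) * u j := by
      simp only [u]
      rw [← pow_add]
      congr 1
      have := (hpow j hj).2
      omega
    rw [h1]
    have h2 : q ≤ q ^ 2 ^ (m - j) := le_self_pow₀ hq1 (by positivity)
    have := hu1 j
    nlinarith
  have htT : t (m + 1) = T := by
    simp only [t]
    rw [Nat.sub_self, pow_zero, hqT]
  have hn : Monotone n := by
    intro i j hij
    refine Nat.floor_le_floor (div_le_div_of_nonneg_right ?_ (by norm_num))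
    refine pow_le_pow_right₀ hq1 (Nat.sub_le_sub_left ?_ _)
    exact Nat.pow_le_pow_right (by norm_num) (Nat.sub_le_sub_left hij _)
  have hnle : ∀ j, (n j : ℝ) ≤ t j / 2 := fun j =>
    Nat.floor_le (div_nonneg (pow_nonneg hq0.le _) (by norm_num))
  have hlt : ∀ j, t j / 2 < n j + 1 := fun j => Nat.lt_floor_add_one _
  have h0 : n 0 = 0 := by
    simp only [n, t, Nat.sub_zero, Nat.sub_self, pow_zero]
    norm_num
  have hnT' : (n (m + 1) : ℝ) ≤ T / 2 := htT ▸ hnle (m + 1)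
  have hTnn : (0 : ℝ) ≤ T := Nat.cast_nonneg T
  have hnT : n (m + 1) ≤ T := by
    have : (n (m + 1) : ℝ) ≤ T := by linarith
    exact_mod_cast this
  refine exists_div_sq_le_envRegret π hk hS hπ hn h0 hnT (δ := fun j => (u j)⁻¹)
    (fun j _ => inv_nonneg.2 (zero_le_one.trans (hu1 j))) (fun j _ => inv_le_one_of_one_le₀ (hu1 j))
    (fun j hj => ?_) (fun j hj => ?_) ?_
  · have h1 := hnle j
    have h2 := hu1 j
    rw [htu j hj] at h1
    rw [inv_pow, ← div_eq_mul_inv, div_le_iff₀ (by positivity)]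
    nlinarith
  · have h1 := hnle j
    have h2 := hlt (j + 1)
    have h3 := hu1 j
    have h4 := hRu j hj
    rw [htu j hj] at h1
    rw [htR j hj] at h2
    rw [inv_mul_eq_div, le_div_iff₀ (by linarith)]
    nlinarith
  · have h3 := hu1 m
    have h5 := htR m le_rfl
    rw [htT] at h5
    have hR : 0 < q ^ 2 ^ m := by positivity
    rw [inv_mul_eq_div, le_div_iff₀ (by linarith)]
    nlinarith

end Phases

/-! ### Assembling the bounds -/

theorem rpow_neg_mul_rpow_neg_le {k m : ℕ} (hk : 2 ≤ k) {α : ℝ} (hα : 1 / 2 ≤ α) :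
    (k : ℝ) ^ (-(3 / 2 : ℝ) - α) * ((m : ℝ) + 1) ^ (-2 : ℝ) ≤ 1 / ((k : ℝ) * (m + 1)) ^ 2 := by
  have hk1 : (1 : ℝ) ≤ k := by exact_mod_cast (by omega : 1 ≤ k)
  have hm : (0 : ℝ) ≤ (m : ℝ) + 1 := by positivity
  have h2 : ∀ x : ℝ, 0 ≤ x → x ^ (-2 : ℝ) = (x ^ 2)⁻¹ := fun x hx => by
    rw [Real.rpow_neg hx]
    norm_cast
  calc (k : ℝ) ^ (-(3 / 2 : ℝ) - α) * ((m : ℝ) + 1) ^ (-2 : ℝ)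
      ≤ (k : ℝ) ^ (-2 : ℝ) * ((m : ℝ) + 1) ^ (-2 : ℝ) := by
        gcongr
        linarith
    _ = 1 / ((k : ℝ) * (m + 1)) ^ 2 := by
        rw [h2 _ (zero_le_one.trans hk1), h2 _ hm, mul_pow, one_div, mul_inv]

theorem le_phaseIndex_succ_mul {k S : ℕ} (hk : 2 ≤ k) (hS : 1 ≤ S) :
    S ≤ (phaseIndex k S + 1) * (k - 1) := by
  have := Nat.lt_div_mul_add (a := S - 1) (b := k - 1) (by omega)
  unfold phaseIndex
  rw [add_mul, one_mul]
  omega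

/-- The lower bound for policies with limited switching, valid for every horizon. -/
theorem exists_rpow_le_envRegret {k m S T : ℕ} [NeZero k] (π : Policy k) (hk : 2 ≤ k)
    (hT : k ≤ T) (hS : S ≤ (m + 1) * (k - 1)) (hπ : π.IsSwitchPolicy S T) :
    ∃ D : Env k, Real.exp (-2) / 108 * ((k : ℝ) ^ (-(3 / 2 : ℝ) -
        1 / (2 - (2 : ℝ) ^ (-(m : ℝ)))) * ((m : ℝ) + 1) ^ (-2 : ℝ)) *
      (T : ℝ) ^ (1 / (2 - (2 : ℝ) ^ (-(m : ℝ)))) ≤ π.envRegret D T := by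
  have hkr : (2 : ℝ) ≤ k := by exact_mod_cast hk
  have hTr : (k : ℝ) ≤ T := by exact_mod_cast hT
  have hT1 : (1 : ℝ) ≤ T := by linarith
  have hA : (1 : ℝ) ≤ 2 ^ m := one_le_pow₀ (by norm_num)
  have hα : 1 / (2 - (2 : ℝ) ^ (-(m : ℝ))) = 2 ^ m / (2 ^ (m + 1) - 1) := by
    rw [Real.rpow_neg (by norm_num), Real.rpow_natCast, pow_succ]
    field_simp
  set α : ℝ := 1 / (2 - (2 : ℝ) ^ (-(m : ℝ)))
  have hden : (0 : ℝ) < 2 ^ (m + 1) - 1 := by rw [pow_succ]; linarith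
  have hα2 : 1 / 2 ≤ α := by
    rw [hα, div_le_div_iff₀ (by norm_num) hden, pow_succ]
    linarith
  set q : ℝ := (T : ℝ) ^ (1 / ((2 : ℝ) ^ (m + 1) - 1)) with hqdef
  have hq1 : 1 ≤ q := Real.one_le_rpow hT1 (by positivity)
  have hqR : q ^ 2 ^ m = (T : ℝ) ^ α := by
    rw [hqdef, ← Real.rpow_mul_natCast (by positivity), hα]
    congr 1
    push_cast
    ring
  have hqT : q ^ (2 ^ (m + 1) - 1) = (T : ℝ) := by
    rw [hqdef, ← Real.rpow_mul_natCast (by positivity), Nat.cast_sub Nat.one_le_two_pow]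
    push_cast
    rw [one_div_mul_cancel hden.ne', Real.rpow_one]
  have hcoef := rpow_neg_mul_rpow_neg_le (m := m) hk hα2
  rw [← hqR]
  have hR0 : 0 < q ^ 2 ^ m := by positivity
  have hkm : (2 : ℝ) ≤ k * (m + 1) := by
    have : (0 : ℝ) ≤ m := Nat.cast_nonneg m
    nlinarith
  rcases le_or_gt 8 q with hq | hq
  · obtain ⟨D, hD⟩ := exists_pow_le_envRegret π hk hS hπ hq hqT
    refine ⟨D, le_trans ?_ hD⟩
    have hm2 : 1 / ((k : ℝ) * (m + 1)) ^ 2 ≤ 4 * (1 / (k * (m + 2) : ℝ)) ^ 2 := by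
      rw [one_div_pow, mul_one_div, div_le_div_iff₀ (by positivity) (by positivity), one_mul]
      have : (k : ℝ) * (m + 2) ≤ 2 * (k * (m + 1)) := by nlinarith [Nat.cast_nonneg (α := ℝ) m]
      calc ((k : ℝ) * (m + 2)) ^ 2 ≤ (2 * (k * (m + 1))) ^ 2 := by gcongr
        _ = 4 * ((k : ℝ) * (m + 1)) ^ 2 := by ring
    calc _ ≤ Real.exp (-2) / 16 * (4 * (1 / (k * (m + 2) : ℝ)) ^ 2) * q ^ 2 ^ m := by
          have := hcoef.trans hm2
          gcongr
          norm_num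
      _ = _ := by ring
  · -- For small `q` the rate `q ^ 2 ^ m` is at most `√(8 T)`.
    obtain ⟨D, hD⟩ := exists_sqrt_le_envRegret π hk hT
    refine ⟨D, le_trans ?_ hD⟩
    have hRT : (q ^ 2 ^ m) ^ 2 ≤ 8 * T := by
      have : (q ^ 2 ^ m) ^ 2 = q * q ^ (2 ^ (m + 1) - 1) := by
        rw [← pow_mul, ← pow_succ, ← pow_succ', Nat.sub_add_cancel Nat.one_le_two_pow]
      rw [this, hqT]
      gcongr
    have hR3 : q ^ 2 ^ m ≤ 3 * √(k * T) := by
      refine abs_le_of_sq_le_sq' ?_ (by positivity) |>.2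
      rw [mul_pow, Real.sq_sqrt (by positivity)]
      nlinarith
    have hone : (k : ℝ) ^ (-(3 / 2 : ℝ) - α) * ((m : ℝ) + 1) ^ (-2 : ℝ) ≤ 1 := by
      refine hcoef.trans ((div_le_one (by positivity)).2 ?_)
      nlinarith
    calc _ ≤ Real.exp (-(3 / 2)) / 108 * 1 * (3 * √(k * T)) := by
          gcongr
          norm_num
      _ = _ := by ring

end Bandit

theorem theorem2 :
    ∃ C : ℝ, 0 < C ∧
      ∀ k S T : ℕ, 2 ≤ k → 1 ≤ S → k ≤ T →
        ∀ π : Bandit.Policy k, π.IsSwitchPolicy S T →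
          (Bandit.LeLogLog (Bandit.phaseIndex k S) k T →
            ((C * ((k : ℝ) ^ (-(3 / 2 : ℝ) -
                    1 / (2 - (2 : ℝ) ^ (-(Bandit.phaseIndex k S : ℝ)))) *
                  ((Bandit.phaseIndex k S : ℝ) + 1) ^ (-2 : ℝ)) *
                (T : ℝ) ^ (1 / (2 - (2 : ℝ) ^ (-(Bandit.phaseIndex k S : ℝ)))) : ℝ) : EReal)
              ≤ π.regret T) ∧
          (¬ Bandit.LeLogLog (Bandit.phaseIndex k S) k T →
            ((C * Real.sqrt ((k : ℝ) * (T : ℝ)) : ℝ) : EReal) ≤ π.regret T) := by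
  refine ⟨Real.exp (-2) / 108, by positivity, fun k S T hk hS hT π hπ => ⟨fun _ => ?_, fun _ => ?_⟩⟩
  · have : NeZero k := ⟨by omega⟩
    obtain ⟨D, hD⟩ := Bandit.exists_rpow_le_envRegret π hk hT
      (Bandit.le_phaseIndex_succ_mul hk hS) hπ
    exact (EReal.coe_le_coe_iff.2 hD).trans (le_iSup (fun D => (π.envRegret D T : EReal)) D)
  · have : NeZero k := ⟨by omega⟩
    obtain ⟨D, hD⟩ := Bandit.exists_sqrt_le_envRegret π hk hT
    have hC : Real.exp (-2) / 108 * √((k : ℝ) * T) ≤ Real.exp (-(3 / 2)) / 36 * √(k * T) := by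
      gcongr <;> norm_num
    exact (EReal.coe_le_coe_iff.2 (hC.trans hD)).trans
      (le_iSup (fun D => (π.envRegret D T : EReal)) D)
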